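/- Let $n\ge 1$ and let $H^n=\{x\in\mathbb{R}^{n+1}: \mathcal B(x,x)=1,\ \mathcal B(x,e)\ge 1\}$ be hyperbolic $n$-space in the hyperboloid model, where $e$ is a fixed unit vector of $\mathbb{R}^{n+1}$, $\mathcal B(x_0+te,\,y_0+se)=ts-\langle x_0,y_0\rangle$ for $x_0,y_0\in e^\perp$ and $t,s\in\mathbb{R}$, and distances are given by $d(x,y)=\operatorname{arcosh}\mathcal B(x,y)$. A set is convex if it contains the geodesic segment between any two of its points. For $p\in H^n$, a unit tangent vector at $p$ is a $v\in\mathbb{R}^{n+1}$ with $\mathcal B(v,p)=0$ and $\mathcal B(v,v)=-1$. If $p\in\partial K$, it is an exterior unit normal to $K$ at $p$ if $\mathcal B(x,v)\ge 0$ for all $x\in K$. For $D>0$, a set $K\subseteq H^n$ is of constant width $D$ if it is compact and convex with non-empty interior, $\operatorname{diam}K=D$, and for every $p\in\partial K$ and every exterior unit normal $v$ to $K$ at $p$, the geodesic segment $[p,q]$ of length $D$ starting at $p$ in the direction $-v$ is contained in $K$. An ideal point $i$ is the linear hull of a vector $w$ with $\mathcal B(w,w)=0$ and $\mathcal B(w,e)>0$.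 The horoballs at $i$ are the sets $A=\{z\in H^n:\mathcal B(z,w)\le s\}$ with $s>0$, bounded by the horospheres $\partial A=\{z\in H^n:\mathcal B(z,w)=s\}$. For horoballs $A_0\subseteq A$ at $i$, let $w(A\setminus\operatorname{int}A_0)=\inf\{d(x,y):x\in\partial A,\ y\in\partial A_0\}$. For bounded $X\subseteq H^n$, the horospherical width $w_i(X)$ of $X$ at $i$ is the minimum of $w(A\setminus \operatorname{int}A_0)$ over all pairs of horoballs $A_0\subseteq A$ at $i$ with $X\subseteq A\setminus\operatorname{int}A_0$. Proposition. Let $D>0$ and let $K\subseteq H^n$ be compact and convex. Then $K$ is of constant width $D$ if and only if $w_i(K)=D$ for every ideal point $i$. -/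

import Mathlib

noncomputable section

namespace Hyp

/-- The ambient space `ℝ^(n+1) = e^⊥ ⊕ ℝ e`; the pair `(x, t)` stands for the vector `x + t e`. -/
abbrev Ambient (n : ℕ) : Type := EuclideanSpace ℝ (Fin n) × ℝ

/-- The distinguished unit vector `e`. -/
def e (n : ℕ) : Ambient n := (0, 1)

/-- The bilinear form `B(x₀ + t e, y₀ + s e) = t s - ⟨x₀, y₀⟩`. -/
def B {n : ℕ} (x y : Ambient n) : ℝ := x.2 * y.2 - inner ℝ x.1 y.1

/-- Hyperbolic `n`-space in the hyperboloid model, with the topology induced from `ℝ^(n+1)`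
(which is also the topology of the hyperbolic metric). -/
abbrev HypSpace (n : ℕ) : Type := {z : Ambient n // 1 ≤ z.2 ∧ B z z = 1}

/-- The hyperbolic (geodesic) distance. -/
def dist {n : ℕ} (x y : HypSpace n) : ℝ := Real.arcosh (B (x : Ambient n) y)

/-- The diameter of a (bounded) set. -/
def diam {n : ℕ} (X : Set (HypSpace n)) : ℝ := sSup (Set.image2 dist X X)

/-- `u` is a unit vector of the tangent space `T_p = {v | B(v, p) = 0}`, whose scalar product
is `-B`. -/
def IsUnitTangent {n : ℕ} (p : HypSpace n) (u : Ambient n) : Prop :=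
  B u p = 0 ∧ B u u = -1

/-- The point at signed arc length `t` on the geodesic line issuing from `p` with direction `u`. -/
def geodesic {n : ℕ} (p : HypSpace n) (u : Ambient n) (t : ℝ) : Ambient n :=
  Real.cosh t • (p : Ambient n) + Real.sinh t • u

/-- The geodesic segment `[x, y]`. -/
def segment {n : ℕ} (x y : HypSpace n) : Set (HypSpace n) :=
  {z | ∃ (u : Ambient n) (t s : ℝ), IsUnitTangent x u ∧ 0 ≤ s ∧ s ≤ t ∧
    (y : Ambient n) = geodesic x u t ∧ (z : Ambient n) = geodesic x u s}

/-- Geodesic convexity. -/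
def IsConvex {n : ℕ} (X : Set (HypSpace n)) : Prop :=
  ∀ x ∈ X, ∀ y ∈ X, segment x y ⊆ X

/-- A convex body: compact and convex with non-empty interior. -/
def IsConvexBody {n : ℕ} (K : Set (HypSpace n)) : Prop :=
  IsCompact K ∧ IsConvex K ∧ (interior K).Nonempty

/-- The closed half-space with boundary hyperplane `{x | B(x, v) = 0}` and exterior normal `v`,
that is, the side of the hyperplane away from which `v` points. -/
def halfSpace {n : ℕ} (v : Ambient n) : Set (HypSpace n) :=
  {x | -B (x : Ambient n) v ≤ 0}

/-- `v` is an exterior unit normal to `K` at the boundary point `p`: it is a unit tangent vector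
at `p`, and the half-space through `p` with exterior normal `v` contains `K`. -/
def IsExteriorUnitNormal {n : ℕ} (K : Set (HypSpace n)) (p : HypSpace n) (v : Ambient n) : Prop :=
  p ∈ frontier K ∧ IsUnitTangent p v ∧ K ⊆ halfSpace v

/-- `K` is a convex body of constant width `D` (in the sense of Dekster). -/
def IsConstantWidth {n : ℕ} (K : Set (HypSpace n)) (D : ℝ) : Prop :=
  0 < D ∧ IsConvexBody K ∧ diam K = D ∧
    ∀ (p : HypSpace n) (v : Ambient n), IsExteriorUnitNormal K p v →
      ∃ q : HypSpace n, (q : Ambient n) = geodesic p (-v) D ∧ segment p q ⊆ K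

/-- An ideal point: the linear hull of some `w` with `B(w, w) = 0` and `B(w, e) > 0`. -/
def IdealPoint (n : ℕ) : Type :=
  {L : Submodule ℝ (Ambient n) //
    ∃ w : Ambient n, B w w = 0 ∧ 0 < B w (e n) ∧ L = Submodule.span ℝ {w}}

/-- `w` is one of the vectors representing the ideal point `i` (they are the positive multiples
of each other). -/
def IdealPoint.IsRep {n : ℕ} (i : IdealPoint n) (w : Ambient n) : Prop :=
  B w w = 0 ∧ 0 < B w (e n) ∧ i.1 = Submodule.span ℝ {w}

/-- The horoball of level `s > 0` at the ideal point represented by `w`. Along a geodesic ray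
tending to the ideal point, `B(·, w)` decreases to `0`. -/
def horoball {n : ℕ} (w : Ambient n) (s : ℝ) : Set (HypSpace n) :=
  {z | B (z : Ambient n) w ≤ s}

/-- The horosphere bounding `horoball w s`. -/
def horosphere {n : ℕ} (w : Ambient n) (s : ℝ) : Set (HypSpace n) :=
  {z | B (z : Ambient n) w = s}

/-- The width of the closed region between the parallel horospheres of levels `s` and `r` at the
ideal point represented by `w`: the distance of the two horospheres. -/
def stripWidth {n : ℕ} (w : Ambient n) (s r : ℝ) : ℝ :=
  sInf (Set.image2 dist (horosphere w s) (horosphere w r))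

/-- The horospherical width `w_i(X)` of a bounded set `X` at the ideal point `i`: the minimal width
of a region `A \ int A₀` containing `X`, where `A₀ ⊆ A` are horoballs at `i`
(the horoball of level `r` lies in that of level `s` when `r ≤ s`). -/
def horosphericalWidth {n : ℕ} (i : IdealPoint n) (X : Set (HypSpace n)) : ℝ :=
  sInf {d | ∃ (w : Ambient n) (s r : ℝ), i.IsRep w ∧ 0 < r ∧ r ≤ s ∧
    X ⊆ horoball w s \ interior (horoball w r) ∧ d = stripWidth w s r}

end Hyp

end

/-! For a null vector `w`, `log B(·, w)` is a Busemann function: it is 1-Lipschitz, and a distance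
`t` forces the increase `t` only along a geodesic coming from the ideal point (`B_le_exp_dist_mul`,
`eq_geodesic_of_exp_mul_le`). Hence the width at an ideal point is the oscillation of this function
on `K` (`horosphericalWidth_eq`).

If `K` has constant width, the diameter bounds the oscillation by `D`. At a minimizer `p` the
direction to the ideal point is an exterior normal, so the chord of length `D` opposite to it lies
in `K`, and the function grows by `D` along it.

Conversely, two points of `K` lie on a geodesic coming from an ideal point, so their distance is at
most the oscillation `D`. Given an exterior normal `v` at `p`, the null vector `p + v` defines a
Busemann function minimal at `p`. Its maximizer `q` has value larger by `D` and distance at most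
`D`, so equality in the Lipschitz bound puts `q` at the end of the required chord. The same argument
excludes that `K` lies in a hyperplane. -/

open Real Set

namespace Hyp

variable {n : ℕ}

/-! ### The Lorentzian form and its signature -/

section Form

@[simp] lemma B_add_left (x y z : Ambient n) : B (x + y) z = B x z + B y z := by
  simp only [B, Prod.fst_add, Prod.snd_add, inner_add_left]; ring

@[simp] lemma B_smul_left (c : ℝ) (x z : Ambient n) : B (c • x) z = c * B x z := by
  simp only [B, Prod.smul_fst, Prod.smul_snd, real_inner_smul_left, smul_eq_mul]; ring

lemma B_comm (x y : Ambient n) : B x y = B y x := by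
  simp only [B, real_inner_comm, mul_comm]

@[simp] lemma B_add_right (x y z : Ambient n) : B x (y + z) = B x y + B x z := by
  rw [B_comm, B_add_left, B_comm y, B_comm z]

@[simp] lemma B_smul_right (c : ℝ) (x z : Ambient n) : B x (c • z) = c * B x z := by
  rw [B_comm, B_smul_left, B_comm]

@[simp] lemma B_neg_left (x z : Ambient n) : B (-x) z = -B x z := by
  simpa using B_smul_left (-1) x z

@[simp] lemma B_neg_right (x z : Ambient n) : B x (-z) = -B x z := by
  simpa using B_smul_right (-1) x z

@[simp] lemma B_sub_left (x y z : Ambient n) : B (x - y) z = B x z - B y z := by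
  rw [sub_eq_add_neg, B_add_left, B_neg_left, sub_eq_add_neg]

@[simp] lemma B_sub_right (x y z : Ambient n) : B x (y - z) = B x y - B x z := by
  rw [sub_eq_add_neg, B_add_right, B_neg_right, sub_eq_add_neg]

lemma B_e (w : Ambient n) : B w (e n) = w.2 := by simp [B, e]

lemma continuous_B_left (w : Ambient n) : Continuous fun x : Ambient n => B x w := by
  unfold B; fun_prop

lemma B_self (x : Ambient n) : B x x = x.2 ^ 2 - ‖x.1‖ ^ 2 := by
  rw [B, real_inner_self_eq_norm_sq]; ring

lemma HypSpace.self (p : HypSpace n) : B (p : Ambient n) p = 1 := p.2.2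

lemma HypSpace.norm_fst_lt (p : HypSpace n) : ‖(p : Ambient n).1‖ < (p : Ambient n).2 := by
  have h := p.self
  rw [B_self] at h
  exact lt_of_pow_lt_pow_left₀ 2 (by linarith [p.2.1]) (by linarith)

/-- The form `B` is negative definite on the tangent space at a point. -/
lemma B_self_neg_of_orthogonal {p : HypSpace n} {z : Ambient n} (h : B z p = 0) (hz : z ≠ 0) :
    B z z < 0 := by
  have hp := p.norm_fst_lt
  have h0 := norm_nonneg (p : Ambient n).1
  have h2 : z.2 * (p : Ambient n).2 = inner ℝ z.1 (p : Ambient n).1 := by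
    unfold B at h; linarith
  have hcs := abs_real_inner_le_norm z.1 (p : Ambient n).1
  rw [← h2, abs_mul, abs_of_pos (h0.trans_lt hp)] at hcs
  have hz1 : 0 < ‖z.1‖ := by
    refine norm_pos_iff.mpr fun h1 => hz ?_
    rw [h1, inner_zero_left] at h2
    exact Prod.ext h1 ((mul_eq_zero.mp h2).resolve_right (h0.trans_lt hp).ne')
  have : |z.2| < ‖z.1‖ := by
    by_contra! hle
    nlinarith [abs_nonneg z.2]
  rw [B_self, ← sq_abs]
  nlinarith [abs_nonneg z.2]

lemma B_self_nonpos_of_orthogonal {p : HypSpace n} {z : Ambient n} (h : B z p = 0) :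
    B z z ≤ 0 := by
  by_cases hz : z = 0
  · simp [hz, B]
  · exact (B_self_neg_of_orthogonal h hz).le

lemma snd_pos_of_B_pos {p : HypSpace n} {z : Ambient n} (h : 0 ≤ B z z) (hp : 0 < B z p) :
    0 < z.2 := by
  by_contra! hle
  rw [B_self] at h
  have h1 : ‖z.1‖ ≤ -z.2 :=
    le_of_sq_le_sq (by linarith) (by linarith)
  have hcs := abs_le.mp (abs_real_inner_le_norm z.1 (p : Ambient n).1)
  have := p.norm_fst_lt
  have := norm_nonneg (p : Ambient n).1
  have := norm_nonneg z.1
  unfold B at hp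
  nlinarith

lemma B_pos_of_snd_pos (p : HypSpace n) {z : Ambient n} (h : 0 ≤ B z z) (hz : 0 < z.2) :
    0 < B (p : Ambient n) z := by
  rw [B_self] at h
  have h1 : ‖z.1‖ ≤ z.2 := le_of_sq_le_sq (by linarith) hz.le
  have hcs := abs_le.mp (abs_real_inner_le_norm (p : Ambient n).1 z.1)
  have := p.norm_fst_lt
  have := norm_nonneg (p : Ambient n).1
  unfold B
  nlinarith

/-- Reversed Cauchy-Schwarz: the component `y - B(x, y) x` is tangent at `x`, where the form is
nonpositive, and its square is `1 - B(x, y)²`. -/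
lemma one_le_B (x y : HypSpace n) : 1 ≤ B (x : Ambient n) y := by
  have hpos : 0 < B (x : Ambient n) y :=
    B_pos_of_snd_pos x (by rw [y.self]; exact zero_le_one) (by linarith [y.2.1])
  have h := B_self_nonpos_of_orthogonal (p := x)
    (z := (y : Ambient n) - B (x : Ambient n) y • (x : Ambient n))
    (by simp [x.self, B_comm (y : Ambient n) x])
  simp only [B_sub_left, B_sub_right, B_smul_left, B_smul_right, x.self, y.self,
    B_comm (y : Ambient n) x] at h
  nlinarith

end Form

/-! ### Geodesics and distance -/

section Geodesic

lemma IsUnitTangent.neg {p : HypSpace n} {u : Ambient n} (h : IsUnitTangent p u) :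
    IsUnitTangent p (-u) := by
  constructor <;> simp [h.1, h.2]

/-- The point of hyperbolic space at signed arc length `t` on a geodesic line. -/
noncomputable def geodesicPoint (p : HypSpace n) (u : Ambient n) (hu : IsUnitTangent p u) (t : ℝ) :
    HypSpace n :=
  ⟨geodesic p u t, by
    have h1 : B (geodesic p u t) (geodesic p u t) = 1 := by
      simp only [geodesic, B_add_left, B_add_right, B_smul_left, B_smul_right, p.self, hu.1, hu.2,
        B_comm (p : Ambient n) u]
      linarith [cosh_sq t]
    have h2 : 0 < (geodesic p u t).2 := by
      refine snd_pos_of_B_pos (p := p) (h1 ▸ zero_le_one) ?_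
      simpa [geodesic, p.self, hu.1] using cosh_pos t
    refine ⟨?_, h1⟩
    rw [B_self] at h1
    nlinarith [sq_nonneg ‖(geodesic p u t).1‖]⟩

@[simp] lemma coe_geodesicPoint (p : HypSpace n) (u : Ambient n) (hu : IsUnitTangent p u) (t : ℝ) :
    (geodesicPoint p u hu t : Ambient n) = geodesic p u t := rfl

lemma continuous_geodesicPoint (p : HypSpace n) (u : Ambient n) (hu : IsUnitTangent p u) :
    Continuous (geodesicPoint p u hu) := by
  refine Continuous.subtype_mk ?_ _
  unfold geodesic
  fun_prop

lemma geodesicPoint_zero (p : HypSpace n) (u : Ambient n) (hu : IsUnitTangent p u) :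
    geodesicPoint p u hu 0 = p := by
  ext1; simp [geodesic]

lemma dist_eq_of_geodesic {x y : HypSpace n} {u : Ambient n} {t : ℝ} (hu : IsUnitTangent x u)
    (ht : 0 ≤ t) (h : (y : Ambient n) = geodesic x u t) : dist x y = t := by
  have : B (x : Ambient n) y = cosh t := by
    rw [h]; simp [geodesic, x.self, B_comm (x : Ambient n) u, hu.1]
  rw [dist, this, arcosh_cosh ht]

lemma dist_nonneg (x y : HypSpace n) : 0 ≤ dist x y := arcosh_nonneg (one_le_B x y)

lemma dist_comm (x y : HypSpace n) : dist x y = dist y x := by rw [dist, B_comm, dist]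

lemma dist_self (x : HypSpace n) : dist x x = 0 := by rw [dist, x.self, arcosh_zero]

/-- The direction is the tangential component `y - B(x, y) x`, normalized by its length `√(b² - 1) =
sinh d(x, y)`. -/
lemma exists_geodesic_of_ne {x y : HypSpace n} (hne : x ≠ y) :
    ∃ u, IsUnitTangent x u ∧ (y : Ambient n) = geodesic x u (dist x y) := by
  set b := B (x : Ambient n) y with hb
  have hz : (y : Ambient n) - b • (x : Ambient n) ≠ 0 := by
    intro h
    have hy : (y : Ambient n) = b • (x : Ambient n) := sub_eq_zero.mp h
    have h1 : b ^ 2 = 1 := by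
      have := y.self
      rw [hy] at this
      simp only [B_smul_left, B_smul_right, x.self] at this
      linarith
    have h2 : b = 1 := by nlinarith [one_le_B x y]
    exact hne (Subtype.ext (by rw [hy, h2, one_smul]))
  have ho : B ((y : Ambient n) - b • (x : Ambient n)) x = 0 := by
    simp [x.self, hb, B_comm (y : Ambient n) x]
  have h := B_self_neg_of_orthogonal ho hz
  have hs : B ((y : Ambient n) - b • (x : Ambient n)) ((y : Ambient n) - b • (x : Ambient n))
      = 1 - b ^ 2 := by
    simp only [B_sub_left, B_sub_right, B_smul_left, B_smul_right, x.self, y.self,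
      B_comm (y : Ambient n) x, ← hb]
    ring
  have hpos : 0 < √(b ^ 2 - 1) := sqrt_pos.mpr (by linarith)
  have hsq : √(b ^ 2 - 1) ^ 2 = b ^ 2 - 1 := sq_sqrt (by linarith)
  refine ⟨(√(b ^ 2 - 1))⁻¹ • ((y : Ambient n) - b • (x : Ambient n)), ⟨?_, ?_⟩, ?_⟩
  · rw [B_smul_left, ho, mul_zero]
  · rw [B_smul_left, B_smul_right, hs]
    field_simp
    linarith
  · rw [geodesic, dist, cosh_arcosh (one_le_B x y), sinh_arcosh (one_le_B x y), ← hb,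
      smul_inv_smul₀ hpos.ne']
    abel

end Geodesic

/-! ### Busemann functions of ideal points -/

section Busemann

/-- The unit tangent vector at `p` pointing to the ideal point represented by `w`. -/
noncomputable def toIdeal (p : HypSpace n) (w : Ambient n) : Ambient n :=
  (B (p : Ambient n) w)⁻¹ • w - (p : Ambient n)

variable {w : Ambient n}

lemma isUnitTangent_toIdeal (p : HypSpace n) (hw : B w w = 0) (hw2 : 0 < w.2) :
    IsUnitTangent p (toIdeal p w) := by
  have h := (B_pos_of_snd_pos p hw.ge hw2).ne'
  constructor
  · simp [toIdeal, p.self, B_comm w p, h]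
  · simp [toIdeal, p.self, B_comm w p, h, hw]

lemma B_geodesic_toIdeal (p : HypSpace n) (hw : B w w = 0) (t : ℝ) :
    B (geodesic p (toIdeal p w) t) w = exp (-t) * B (p : Ambient n) w := by
  simp only [geodesic, toIdeal, B_add_left, B_smul_left, B_sub_left, hw, cosh_eq, sinh_eq]
  ring

/-- Splits `w` into its components along `p` and tangent to `p`, which turns values of the Busemann
function into angles at `p`. -/
lemma B_eq_mul_one_add (p : HypSpace n) (hw : B w w = 0) (hw2 : 0 < w.2) (x : Ambient n) :
    B x w = B (p : Ambient n) w * (B x p + B x (toIdeal p w)) := by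
  have h := (B_pos_of_snd_pos p hw.ge hw2).ne'
  simp [toIdeal, mul_inv_cancel_left₀ h]

lemma B_unitTangent_le_one {p : HypSpace n} {u v : Ambient n} (hu : IsUnitTangent p u)
    (hv : IsUnitTangent p v) : B u v ≤ 1 := by
  have h := B_self_nonpos_of_orthogonal (p := p) (z := u + v) (by simp [hu.1, hv.1])
  simp only [B_add_left, B_add_right, hu.2, hv.2, B_comm v u] at h
  linarith

lemma eq_neg_of_one_le_B_unitTangent {p : HypSpace n} {u v : Ambient n} (hu : IsUnitTangent p u)
    (hv : IsUnitTangent p v) (huv : 1 ≤ B u v) : u = -v := by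
  by_contra hne
  have h := B_self_neg_of_orthogonal (p := p) (z := u + v) (by simp [hu.1, hv.1])
    (fun h => hne (eq_neg_of_add_eq_zero_left h))
  simp only [B_add_left, B_add_right, hu.2, hv.2, B_comm v u] at h
  linarith

/-- Busemann functions are `1`-Lipschitz. -/
lemma B_le_exp_dist_mul (x y : HypSpace n) (hw : B w w = 0) (hw2 : 0 < w.2) :
    B (x : Ambient n) w ≤ exp (dist x y) * B (y : Ambient n) w := by
  by_cases hne : y = x
  · rw [hne, dist_self]; simp
  obtain ⟨u, hu, hx⟩ := exists_geodesic_of_ne hne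
  rw [dist_comm x y]
  set t := dist y x
  have ht : 0 ≤ t := dist_nonneg y x
  have hv := B_unitTangent_le_one hu (isUnitTangent_toIdeal y hw hw2)
  have hpos := B_pos_of_snd_pos y hw.ge hw2
  have hc : cosh t + sinh t * B u (toIdeal y w) ≤ exp t := by
    rw [← cosh_add_sinh]
    nlinarith [sinh_nonneg_iff.mpr ht]
  rw [hx, geodesic, B_add_left, B_smul_left, B_smul_left, B_eq_mul_one_add y hw hw2 u, hu.1]
  nlinarith

/-- Equality in the Lipschitz estimate holds only along geodesics from the ideal point. -/
lemma eq_geodesic_of_exp_mul_le {x y : HypSpace n} (hw : B w w = 0) (hw2 : 0 < w.2) {t : ℝ}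
    (ht : 0 < t) (hd : dist x y ≤ t)
    (h : exp t * B (y : Ambient n) w ≤ B (x : Ambient n) w) :
    (x : Ambient n) = geodesic y (-toIdeal y w) t := by
  have hpos := B_pos_of_snd_pos y hw.ge hw2
  have hle := h.trans (B_le_exp_dist_mul x y hw hw2)
  have hdt : dist x y = t := le_antisymm hd (exp_le_exp.mp (le_of_mul_le_mul_right hle hpos))
  have hne : y ≠ x := by
    rintro rfl
    rw [dist_self] at hdt
    exact ht.ne hdt
  obtain ⟨u, hu, hx⟩ := exists_geodesic_of_ne hne
  rw [dist_comm, hdt] at hx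
  have hv := isUnitTangent_toIdeal y hw hw2
  rw [hx, geodesic, B_add_left, B_smul_left, B_smul_left, B_eq_mul_one_add y hw hw2 u, hu.1,
    ← cosh_add_sinh] at h
  have hs := sinh_pos_iff.mpr ht
  have h1 : 1 ≤ B u (toIdeal y w) := by
    by_contra! hlt
    nlinarith [mul_pos (mul_pos hs hpos) (sub_pos.mpr hlt)]
  rw [hx, eq_neg_of_one_le_B_unitTangent hu hv h1]

end Busemann

/-! ### Horospherical width as oscillation -/

section Width

variable {w : Ambient n}

lemma interior_horoball (hw : B w w = 0) (hw2 : 0 < w.2) (s : ℝ) :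
    interior (horoball w s) = {z : HypSpace n | B (z : Ambient n) w < s} := by
  have hcont : Continuous fun z : HypSpace n => B (z : Ambient n) w :=
    (continuous_B_left w).comp continuous_subtype_val
  refine Subset.antisymm (fun z hz => ?_)
    (interior_maximal (fun z (hz : B (z : Ambient n) w < s) => hz.le)
      (isOpen_lt hcont continuous_const))
  have hv := isUnitTangent_toIdeal z hw hw2
  -- Moving slightly away from the ideal point (`t < 0`) stays in the horoball but strictly
  -- increases `B(·, w)`.
  have hev : ∀ᶠ t in nhds (0 : ℝ), geodesicPoint z _ hv t ∈ horoball w s := by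
    refine (continuous_geodesicPoint z _ hv).continuousAt.eventually_mem ?_
    rw [geodesicPoint_zero]
    exact mem_interior_iff_mem_nhds.mp hz
  obtain ⟨t, ht, ht0⟩ :=
    ((hev.filter_mono nhdsWithin_le_nhds).and (self_mem_nhdsWithin (s := Iio (0 : ℝ)))).exists
  have ht1 : exp (-t) * B (z : Ambient n) w ≤ s := by
    rw [← B_geodesic_toIdeal z hw]; exact ht
  have h1 : 1 < exp (-t) := one_lt_exp_iff.mpr (neg_pos.mpr ht0)
  show B (z : Ambient n) w < s
  nlinarith [B_pos_of_snd_pos z hw.ge hw2]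

/-- The base point of the hyperboloid. -/
def basePoint (n : ℕ) : HypSpace n := ⟨e n, by simp [e], by simp [B, e]⟩

/-- The Lipschitz estimate is the lower bound; a geodesic towards the ideal point attains it. -/
lemma stripWidth_eq (hw : B w w = 0) (hw2 : 0 < w.2) {s r : ℝ} (hr : 0 < r) (hrs : r ≤ s) :
    stripWidth w s r = log (s / r) := by
  have hs := hr.trans_le hrs
  have key : ∀ (p : HypSpace n) {c : ℝ}, 0 < c →
      B (geodesic p (toIdeal p w) (log (B (p : Ambient n) w / c))) w = c := by
    intro p c hc
    have hp := B_pos_of_snd_pos p hw.ge hw2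
    rw [B_geodesic_toIdeal p hw, exp_neg, exp_log (div_pos hp hc)]
    field_simp
  refine IsLeast.csInf_eq ⟨?_, ?_⟩
  · set x := geodesicPoint (basePoint n) _ (isUnitTangent_toIdeal (basePoint n) hw hw2)
      (log (B (basePoint n : Ambient n) w / s))
    have hx : B (x : Ambient n) w = s := key _ hs
    refine ⟨x, hx, geodesicPoint x _ (isUnitTangent_toIdeal x hw hw2) (log (s / r)), ?_, ?_⟩
    · have := key x hr
      rwa [hx] at this
    · exact dist_eq_of_geodesic (isUnitTangent_toIdeal x hw hw2)
        (log_nonneg ((one_le_div hr).mpr hrs)) rfl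
  · rintro _ ⟨x, hx, y, hy, rfl⟩
    have h := B_le_exp_dist_mul x y hw hw2
    rw [show B (x : Ambient n) w = s from hx, show B (y : Ambient n) w = r from hy] at h
    rw [log_le_iff_le_exp (div_pos hs hr), div_le_iff₀ hr]
    exact h

lemma IdealPoint.exists_isRep (i : IdealPoint n) : ∃ w, i.IsRep w := i.2

lemma IdealPoint.IsRep.null {i : IdealPoint n} (h : i.IsRep w) : B w w = 0 := h.1

lemma IdealPoint.IsRep.snd_pos {i : IdealPoint n} (h : i.IsRep w) : 0 < w.2 := by
  rw [← B_e]; exact h.2.1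

lemma exists_idealPoint (hw : B w w = 0) (hw2 : 0 < w.2) : ∃ i : IdealPoint n, i.IsRep w :=
  ⟨⟨_, w, hw, by rwa [B_e], rfl⟩, hw, by rwa [B_e], rfl⟩

lemma IdealPoint.IsRep.exists_smul {i : IdealPoint n} {w' : Ambient n} (h : i.IsRep w)
    (h' : i.IsRep w') : ∃ c : ℝ, 0 < c ∧ w' = c • w := by
  have hmem : w' ∈ Submodule.span ℝ {w} := by
    rw [← h.2.2, h'.2.2]; exact Submodule.mem_span_singleton_self w'
  obtain ⟨c, rfl⟩ := Submodule.mem_span_singleton.mp hmem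
  have h2 : 0 < c * w.2 := h'.snd_pos
  exact ⟨c, pos_of_mul_pos_left h2 h.snd_pos.le, rfl⟩

/-- The horospherical width is the oscillation of the Busemann function. -/
lemma horosphericalWidth_eq {i : IdealPoint n} (h : i.IsRep w) {K : Set (HypSpace n)}
    {x p : HypSpace n} (hx : x ∈ K) (hp : p ∈ K)
    (hmax : ∀ z ∈ K, B (z : Ambient n) w ≤ B (x : Ambient n) w)
    (hmin : ∀ z ∈ K, B (p : Ambient n) w ≤ B (z : Ambient n) w) :
    horosphericalWidth i K = log (B (x : Ambient n) w / B (p : Ambient n) w) := by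
  have hpos := fun z : HypSpace n => B_pos_of_snd_pos z h.null.ge h.snd_pos
  refine IsLeast.csInf_eq ⟨?_, ?_⟩
  · refine ⟨w, _, _, h, hpos p, hmin x hx, fun z hz => ⟨hmax z hz, ?_⟩,
      (stripWidth_eq h.null h.snd_pos (hpos p) (hmin x hx)).symm⟩
    rw [interior_horoball h.null h.snd_pos]
    exact (hmin z hz).not_gt
  · rintro _ ⟨w', s, r, h', hr, hrs, hK, rfl⟩
    rw [stripWidth_eq h'.null h'.snd_pos hr hrs]
    -- Another representative rescales both levels by `c`, which cancels in the ratio.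
    obtain ⟨c, hc, rfl⟩ := h.exists_smul h'
    have h1 : B (x : Ambient n) (c • w) ≤ s := (hK hx).1
    have h2 := (hK hp).2
    rw [interior_horoball h'.null h'.snd_pos] at h2
    have h3 : r ≤ B (p : Ambient n) (c • w) := not_lt.mp h2
    rw [B_smul_right] at h1 h3
    rw [← mul_div_mul_left _ _ hc.ne']
    have hs := (hr.trans_le hrs).le
    have := mul_pos hc (hpos x)
    have := mul_pos hc (hpos p)
    gcongr

lemma horosphericalWidth_empty (i : IdealPoint n) : horosphericalWidth i ∅ = 0 := by
  obtain ⟨w, h⟩ := i.exists_isRep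
  refine IsLeast.csInf_eq ⟨⟨w, 1, 1, h, one_pos, le_rfl, empty_subset _, ?_⟩, ?_⟩
  · rw [stripWidth_eq h.null h.snd_pos one_pos le_rfl]; simp
  · rintro _ ⟨w', s, r, h', hr, hrs, -, rfl⟩
    rw [stripWidth_eq h'.null h'.snd_pos hr hrs]
    exact log_nonneg ((one_le_div hr).mpr hrs)

end Width

/-! ### Extremal points and supporting half-spaces -/

section Compact

variable {K : Set (HypSpace n)}

lemma exists_min_max (hK : IsCompact K) (hne : K.Nonempty) (w : Ambient n) :
    ∃ p ∈ K, ∃ x ∈ K, (∀ z ∈ K, B (p : Ambient n) w ≤ B (z : Ambient n) w) ∧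
      ∀ z ∈ K, B (z : Ambient n) w ≤ B (x : Ambient n) w := by
  have hcont : ContinuousOn (fun z : HypSpace n => B (z : Ambient n) w) K :=
    ((continuous_B_left w).comp continuous_subtype_val).continuousOn
  obtain ⟨p, hp, hmin⟩ := hK.exists_isMinOn hne hcont
  obtain ⟨x, hx, hmax⟩ := hK.exists_isMaxOn hne hcont
  exact ⟨p, hp, x, hx, fun z hz => hmin hz, fun z hz => hmax hz⟩

lemma dist_le_diam (hD : 0 < diam K) {x y : HypSpace n} (hx : x ∈ K) (hy : y ∈ K) :
    dist x y ≤ diam K := by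
  refine le_csSup ?_ ⟨x, hx, y, hy, rfl⟩
  -- The supremum of an unbounded set is `0` by convention, so positivity of `diam K` supplies the
  -- bound.
  by_contra h
  rw [diam, Real.sSup_of_not_bddAbove h] at hD
  exact hD.false

/-- The nearest point of a convex set to an ideal point has the direction of the ideal point as an
exterior normal. -/
lemma isExteriorUnitNormal_toIdeal (hconv : IsConvex K) {w : Ambient n} (hw : B w w = 0)
    (hw2 : 0 < w.2) {p : HypSpace n} (hp : p ∈ K)
    (hmin : ∀ z ∈ K, B (p : Ambient n) w ≤ B (z : Ambient n) w) :
    IsExteriorUnitNormal K p (toIdeal p w) := by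
  have hv := isUnitTangent_toIdeal p hw hw2
  have hpos := B_pos_of_snd_pos p hw.ge hw2
  refine ⟨⟨subset_closure hp, fun hint => ?_⟩, hv, fun x hx => ?_⟩
  · have hev : ∀ᶠ t in nhds (0 : ℝ), geodesicPoint p _ hv t ∈ K := by
      refine (continuous_geodesicPoint p _ hv).continuousAt.eventually_mem ?_
      rw [geodesicPoint_zero]
      exact mem_interior_iff_mem_nhds.mp hint
    obtain ⟨t, ht, ht0⟩ :=
      ((hev.filter_mono nhdsWithin_le_nhds).and (self_mem_nhdsWithin (s := Ioi (0 : ℝ)))).exists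
    have h1 := hmin _ ht
    rw [coe_geodesicPoint, B_geodesic_toIdeal p hw] at h1
    have h2 : exp (-t) < 1 := by rw [exp_lt_one_iff]; exact neg_neg_of_pos ht0
    nlinarith
  · show -B (x : Ambient n) (toIdeal p w) ≤ 0
    by_cases hne : p = x
    · rw [← hne, B_comm, hv.1, neg_zero]
    obtain ⟨u, hu, hxe⟩ := exists_geodesic_of_ne hne
    set T := dist p x
    have hT0 : 0 ≤ T := dist_nonneg p x
    have hT : 0 < T := by
      refine hT0.lt_of_ne fun h0 => hne ?_
      ext1
      rw [hxe, ← h0]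
      simp [geodesic]
    have hux : B (x : Ambient n) (toIdeal p w) = sinh T * B u (toIdeal p w) := by
      rw [hxe, geodesic, B_add_left, B_smul_left, B_smul_left, B_comm (p : Ambient n), hv.1]
      ring
    have hseg : ∀ t, 0 ≤ t → t ≤ T → 1 ≤ cosh t + sinh t * B u (toIdeal p w) := by
      intro t ht htT
      have h1 := hmin _ (hconv p hp x hx
        (show geodesicPoint p u hu t ∈ segment p x from ⟨u, T, t, hu, ht, htT, hxe, rfl⟩))
      rw [coe_geodesicPoint, geodesic, B_add_left, B_smul_left, B_smul_left,
        B_eq_mul_one_add p hw hw2 u, hu.1] at h1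
      by_contra! hlt
      nlinarith [mul_pos hpos (sub_pos.mpr hlt)]
    rw [hux, neg_nonpos]
    refine mul_nonneg (sinh_nonneg_iff.mpr hT0) ?_
    by_contra! hneg
    -- The function in `hseg` equals `1` at `0`; a negative slope there would take it below `1` for
    -- small `t > 0`.
    have hderiv : HasDerivAt (fun t => cosh t + sinh t * B u (toIdeal p w))
        (sinh 0 + cosh 0 * B u (toIdeal p w)) 0 :=
      (hasDerivAt_cosh 0).add ((hasDerivAt_sinh 0).mul_const _)
    rw [sinh_zero, cosh_zero, one_mul, zero_add] at hderiv
    have hev := (hderiv.tendsto_slope_zero_right.eventually_lt_const hneg).and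
      (Ioc_mem_nhdsGT hT)
    obtain ⟨t, hlt, ht0, htT⟩ := hev.exists
    have h1 := hseg t ht0.le htT
    rw [zero_add, sinh_zero, cosh_zero, zero_mul, add_zero, smul_eq_mul] at hlt
    have h2 := neg_of_mul_neg_right hlt (inv_pos.mpr ht0).le
    linarith

end Compact

/-! ### Spanning convex sets have interior points -/

section Interior

variable {K : Set (HypSpace n)}

/-- Nondegeneracy of `B`: a nonzero functional vanishing on `K` is represented by its Riesz vector
with the spatial part negated. -/
lemma exists_normal_of_span_ne_top (h : Submodule.span ℝ ((↑) '' K : Set (Ambient n)) ≠ ⊤) :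
    ∃ u : Ambient n, u ≠ 0 ∧ ∀ x ∈ K, B u (x : Ambient n) = 0 := by
  obtain ⟨f, hf, hle⟩ := Submodule.exists_le_ker_of_lt_top _ h.lt_top
  set a := (InnerProductSpace.toDual ℝ (EuclideanSpace ℝ (Fin n))).symm
    (LinearMap.toContinuousLinearMap (f ∘ₗ LinearMap.inl ℝ _ ℝ)) with ha
  have hB : ∀ x : Ambient n, B ((-a, f (0, 1)) : Ambient n) x = f x := by
    intro x
    have h1 : inner ℝ a x.1 = f (x.1, 0) := by
      rw [ha, InnerProductSpace.toDual_symm_apply]; simp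
    have h2 : f x = f (x.1, 0) + x.2 * f (0, 1) := by
      rw [← smul_eq_mul, ← map_smul, ← map_add]; simp
    simp only [B, inner_neg_left, h1, h2]
    ring
  refine ⟨(-a, f (0, 1)), fun h0 => hf ?_, fun x hx => ?_⟩
  · refine LinearMap.ext fun x => ?_
    rw [← hB, h0]
    simp [B]
  · rw [hB]
    exact hle (Submodule.subset_span ⟨x, hx, rfl⟩)

/-- The cone over a set of points of the hyperboloid. -/
def cone (K : Set (HypSpace n)) : Set (Ambient n) :=
  {z | ∃ t : ℝ, 0 < t ∧ ∃ x ∈ K, z = t • (x : Ambient n)}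

lemma add_mem_cone (hconv : IsConvex K) {x y : HypSpace n} (hx : x ∈ K) (hy : y ∈ K) {s t : ℝ}
    (hs : 0 < s) (ht : 0 < t) : s • (x : Ambient n) + t • (y : Ambient n) ∈ cone K := by
  by_cases hne : x = y
  · exact ⟨s + t, by positivity, x, hx, by rw [← hne, add_smul]⟩
  obtain ⟨u, hu, hye⟩ := exists_geodesic_of_ne hne
  set T := dist x y
  have hT : 0 ≤ T := dist_nonneg x y
  have hsT : 0 ≤ sinh T := sinh_nonneg_iff.mpr hT
  have hcT := cosh_pos T
  have hN : 0 < (s + t * cosh T) ^ 2 - (t * sinh T) ^ 2 := by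
    have := cosh_sq T
    have : (s + t * cosh T) ^ 2 - (t * sinh T) ^ 2 = s ^ 2 + t ^ 2 + 2 * s * t * cosh T := by
      linear_combination t ^ 2 * this
    rw [this]; positivity
  set N := √((s + t * cosh T) ^ 2 - (t * sinh T) ^ 2)
  have hNpos : 0 < N := sqrt_pos.mpr hN
  have hNsq : N ^ 2 = (s + t * cosh T) ^ 2 - (t * sinh T) ^ 2 := sq_sqrt hN.le
  -- In the plane of `x` and `u`, the sum is `N (cosh r x + sinh r u)`: `N` is its Lorentzian length
  -- and `r` its arc length from `x`.
  set r := arsinh (t * sinh T / N)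
  have hsr : sinh r = t * sinh T / N := sinh_arsinh _
  have hcr : cosh r = (s + t * cosh T) / N := by
    rw [cosh_arsinh, sqrt_eq_iff_mul_self_eq (by positivity) (by positivity)]
    field_simp
    linarith
  refine ⟨N, hNpos, geodesicPoint x u hu r, hconv x hx y hy ⟨u, T, r, hu, ?_, ?_, hye, rfl⟩, ?_⟩
  · exact arsinh_nonneg_iff.mpr (by positivity)
  · rw [← sub_nonneg, ← sinh_nonneg_iff, sinh_sub, hsr, hcr]
    have : sinh T * ((s + t * cosh T) / N) - cosh T * (t * sinh T / N) = s * sinh T / N := by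
      ring
    rw [this]; positivity
  · have hcancel : ∀ a : ℝ, N * (a / N) = a := fun a => mul_div_cancel₀ a hNpos.ne'
    simp only [coe_geodesicPoint, geodesic, hsr, hcr, hye, smul_add, smul_smul, hcancel]
    module

lemma convex_cone (hconv : IsConvex K) : Convex ℝ (cone K) := by
  refine convex_iff_forall_pos.mpr ?_
  rintro _ ⟨s, hs, x, hx, rfl⟩ _ ⟨t, ht, y, hy, rfl⟩ a b ha hb -
  rw [smul_smul, smul_smul]
  exact add_mem_cone hconv hx hy (mul_pos ha hs) (mul_pos hb ht)

lemma affineSpan_cone (hne : K.Nonempty)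
    (h : Submodule.span ℝ ((↑) '' K : Set (Ambient n)) = ⊤) : affineSpan ℝ (cone K) = ⊤ := by
  obtain ⟨x, hx⟩ := hne
  have hmem : ∀ z ∈ K, ∀ t : ℝ, 0 < t → t • (z : Ambient n) ∈ affineSpan ℝ (cone K) :=
    fun z hz t ht => subset_affineSpan ℝ _ ⟨t, ht, z, hz, rfl⟩
  have h0 : (0 : Ambient n) ∈ affineSpan ℝ (cone K) := by
    -- The origin lies on the line through `x` and `2x`.
    have := AffineMap.lineMap_mem (-1 : ℝ) (hmem x hx 1 one_pos) (hmem x hx 2 two_pos)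
    convert this using 1
    rw [AffineMap.lineMap_apply_module']
    module
  have hcone : (cone K).Nonempty := ⟨_, 1, one_pos, x, hx, rfl⟩
  rw [AffineSubspace.affineSpan_eq_top_iff_vectorSpan_eq_top_of_nonempty ℝ _ _ hcone, eq_top_iff, ← h, Submodule.span_le, ← direction_affineSpan]
  rintro _ ⟨z, hz, rfl⟩
  simpa using AffineSubspace.vsub_mem_direction (hmem z hz 1 one_pos) h0

/-- The cone over `K` is convex and affinely spans, so it has an interior point `t • x`; a point `z`
near `x` has `t • z` in the cone, and comparing `B`-lengths gives `z ∈ K`. -/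
lemma interior_nonempty_of_span_eq_top (hconv : IsConvex K) (hne : K.Nonempty)
    (h : Submodule.span ℝ ((↑) '' K : Set (Ambient n)) = ⊤) : (interior K).Nonempty := by
  obtain ⟨y, hy⟩ :=
    (convex_cone hconv).interior_nonempty_iff_affineSpan_eq_top.mpr (affineSpan_cone hne h)
  obtain ⟨t, ht, x, hx, rfl⟩ := interior_subset hy
  refine ⟨x, mem_interior.mpr ⟨{z | t • (z : Ambient n) ∈ interior (cone K)}, fun z hz => ?_,
    isOpen_interior.preimage (by fun_prop), hy⟩⟩
  obtain ⟨s, hs, k, hk, hzk⟩ := interior_subset hz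
  have h2 : t ^ 2 = s ^ 2 := by
    have := congrArg (fun v => B v v) hzk
    simp only [B_smul_left, B_smul_right, HypSpace.self] at this
    linarith
  have hts : t = s := by nlinarith
  subst hts
  rwa [Subtype.ext (smul_right_injective _ ht.ne' hzk)]

end Interior

/-! ### The two implications -/

section Main

variable {K : Set (HypSpace n)} {D : ℝ}

lemma IsConstantWidth.horosphericalWidth_eq (h : IsConstantWidth K D) (i : IdealPoint n) :
    horosphericalWidth i K = D := by
  obtain ⟨hD, ⟨hK, hconv, hint⟩, hdiam, hnormal⟩ := h
  obtain ⟨w, hw⟩ := i.exists_isRep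
  obtain ⟨p, hp, x, hx, hmin, hmax⟩ := exists_min_max hK (hint.mono interior_subset) w
  have hpos := fun z : HypSpace n => B_pos_of_snd_pos z hw.null.ge hw.snd_pos
  rw [Hyp.horosphericalWidth_eq hw hx hp hmax hmin]
  apply le_antisymm
  · rw [log_le_iff_le_exp (div_pos (hpos x) (hpos p)), div_le_iff₀ (hpos p)]
    refine (B_le_exp_dist_mul x p hw.null hw.snd_pos).trans ?_
    have := dist_le_diam (hdiam ▸ hD) hx hp
    rw [hdiam] at this
    have := hpos p
    gcongr
  · obtain ⟨q, hq, hseg⟩ :=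
      hnormal p _ (isExteriorUnitNormal_toIdeal hconv hw.null hw.snd_pos hp hmin)
    have hv := (isUnitTangent_toIdeal p hw.null hw.snd_pos).neg
    have hqK : q ∈ K := hseg ⟨_, D, D, hv, hD.le, le_rfl, hq, hq⟩
    have hBq : B (q : Ambient n) w = exp D * B (p : Ambient n) w := by
      have := B_geodesic_toIdeal p hw.null (-D)
      rw [neg_neg] at this
      rw [← this, hq]
      simp [geodesic]
    rw [le_log_iff_exp_le (div_pos (hpos x) (hpos p)), le_div_iff₀ (hpos p), ← hBq]
    exact hmax q hqK

lemma dist_le_of_horosphericalWidth_eq (hD : 0 < D) (hK : IsCompact K)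
    (h : ∀ i : IdealPoint n, horosphericalWidth i K = D) {x y : HypSpace n} (hx : x ∈ K)
    (hy : y ∈ K) : dist x y ≤ D := by
  by_cases hne : x = y
  · rw [hne, dist_self]; exact hD.le
  obtain ⟨u, hu, hye⟩ := exists_geodesic_of_ne hne
  set T := dist x y
  -- The ideal point behind `x` on the line to `y`: along this line `B(·, w)` is the exponential of
  -- arc length from `x`.
  set w : Ambient n := (x : Ambient n) - u
  have hxw : B (x : Ambient n) w = 1 := by
    simp [w, x.self, B_comm (x : Ambient n) u, hu.1]
  have huw : B u w = 1 := by simp [w, hu.1, hu.2]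
  have hw : B w w = 0 := by
    rw [show B w w = B (x : Ambient n) w - B u w from B_sub_left _ _ _, hxw, huw, sub_self]
  have hw2 : 0 < w.2 := snd_pos_of_B_pos (p := x) hw.ge (by rw [B_comm, hxw]; exact one_pos)
  have hyw : B (y : Ambient n) w = exp T := by
    rw [hye, geodesic, B_add_left, B_smul_left, B_smul_left, hxw, huw, mul_one, mul_one,
      cosh_add_sinh]
  obtain ⟨i, hi⟩ := exists_idealPoint hw hw2
  obtain ⟨p, hp, q, hq, hmin, hmax⟩ := exists_min_max hK ⟨x, hx⟩ w
  have hpos := fun z : HypSpace n => B_pos_of_snd_pos z hw.ge hw2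
  rw [← h i, Hyp.horosphericalWidth_eq hi hq hp hmax hmin,
    le_log_iff_exp_le (div_pos (hpos q) (hpos p)), le_div_iff₀ (hpos p), ← hyw]
  have h1 := hmin x hx
  rw [hxw] at h1
  nlinarith [hmax y hy, hpos y]

/-- At every supporting half-space, the opposite end of the chord of length `D` is in `K`. -/
lemma exists_mem_eq_geodesic_of_horosphericalWidth_eq (hD : 0 < D) (hK : IsCompact K)
    (h : ∀ i : IdealPoint n, horosphericalWidth i K = D) {p : HypSpace n} (hp : p ∈ K)
    {v : Ambient n} (hv : IsUnitTangent p v) (hsub : K ⊆ halfSpace v) :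
    ∃ q ∈ K, (q : Ambient n) = geodesic p (-v) D := by
  set w : Ambient n := (p : Ambient n) + v with hwdef
  have hpw : B (p : Ambient n) w = 1 := by
    simp [w, p.self, B_comm (p : Ambient n) v, hv.1]
  have hvw : B v w = -1 := by simp [w, hv.1, hv.2]
  have hw : B w w = 0 := by
    rw [show B w w = B (p : Ambient n) w + B v w from B_add_left _ _ _, hpw, hvw]; norm_num
  have hw2 : 0 < w.2 := snd_pos_of_B_pos (p := p) hw.ge (by rw [B_comm, hpw]; exact one_pos)
  have htw : toIdeal p w = v := by rw [toIdeal, hpw, inv_one, one_smul, hwdef]; abel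
  obtain ⟨i, hi⟩ := exists_idealPoint hw hw2
  obtain ⟨-, -, q, hq, -, hmax⟩ := exists_min_max hK ⟨p, hp⟩ w
  -- The half-space misses the open horoball through `p` at the ideal point: `B(z, p) ≥ 1` and `B(z,
  -- v) ≥ 0`.
  have hmin : ∀ z ∈ K, B (p : Ambient n) w ≤ B (z : Ambient n) w := by
    intro z hz
    have h1 : -B (z : Ambient n) v ≤ 0 := hsub hz
    have h2 := one_le_B z p
    rw [hpw, hwdef, B_add_right]
    linarith
  have hDw := h i
  have hqpos := B_pos_of_snd_pos q hw.ge hw2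
  rw [Hyp.horosphericalWidth_eq hi hq hp hmax hmin, hpw, div_one] at hDw
  refine ⟨q, hq, ?_⟩
  rw [← htw]
  refine eq_geodesic_of_exp_mul_le hw hw2 hD (dist_le_of_horosphericalWidth_eq hD hK h hq hp) ?_
  rw [hpw, mul_one, ← hDw, exp_log hqpos]

/-- If `K` lay in a hyperplane, the unit normal `v` of that hyperplane would be admissible at `p ∈
K`, and the opposite end of the resulting chord, a point of `K`, would leave the hyperplane. -/
lemma interior_nonempty_of_horosphericalWidth_eq (hD : 0 < D) (hK : IsCompact K)
    (hconv : IsConvex K) (hne : K.Nonempty)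
    (h : ∀ i : IdealPoint n, horosphericalWidth i K = D) : (interior K).Nonempty := by
  by_cases hspan : Submodule.span ℝ ((↑) '' K : Set (Ambient n)) = ⊤
  · exact interior_nonempty_of_span_eq_top hconv hne hspan
  exfalso
  obtain ⟨u, hu0, hu⟩ := exists_normal_of_span_ne_top hspan
  obtain ⟨p, hp⟩ := hne
  have hneg := B_self_neg_of_orthogonal (hu p hp) hu0
  set v := (√(-B u u))⁻¹ • u
  have hsq : √(-B u u) ^ 2 = -B u u := sq_sqrt (by linarith)
  have hpos : 0 < √(-B u u) := sqrt_pos.mpr (by linarith)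
  have hvK : ∀ x ∈ K, B (x : Ambient n) v = 0 := fun x hx => by
    simp [v, B_comm (x : Ambient n) u, hu x hx]
  have hv : IsUnitTangent p v := by
    refine ⟨by rw [B_comm, hvK p hp], ?_⟩
    rw [B_smul_left, B_smul_right]
    field_simp
    linarith
  obtain ⟨q, hq, hqe⟩ := exists_mem_eq_geodesic_of_horosphericalWidth_eq hD hK h hp hv
    fun x hx => show -B (x : Ambient n) v ≤ 0 by rw [hvK x hx, neg_zero]
  have h1 := hvK q hq
  rw [hqe, geodesic, B_add_left, B_smul_left, B_smul_left, B_neg_left, hv.2, hvK p hp] at h1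
  linarith [sinh_pos_iff.mpr hD]

lemma exists_null_vector (hn : 1 ≤ n) : ∃ w : Ambient n, B w w = 0 ∧ 0 < w.2 :=
  ⟨(EuclideanSpace.single ⟨0, hn⟩ 1, 1), by simp [B_self], one_pos⟩

lemma isConstantWidth_of_horosphericalWidth_eq (hn : 1 ≤ n) (hD : 0 < D) (hK : IsCompact K)
    (hconv : IsConvex K) (h : ∀ i : IdealPoint n, horosphericalWidth i K = D) :
    IsConstantWidth K D := by
  obtain ⟨w, hw, hw2⟩ := exists_null_vector hn
  obtain ⟨i, hi⟩ := exists_idealPoint hw hw2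
  have hne : K.Nonempty := by
    rw [nonempty_iff_ne_empty]
    rintro rfl
    exact hD.ne ((horosphericalWidth_empty i).symm.trans (h i))
  refine ⟨hD, ⟨hK, hconv, interior_nonempty_of_horosphericalWidth_eq hD hK hconv hne h⟩,
    IsGreatest.csSup_eq ⟨?_, ?_⟩, ?_⟩
  -- The diameter is attained by the extremal points for any ideal point; one exists because `1 ≤
  -- n`.
  · obtain ⟨p, hp, x, hx, hmin, hmax⟩ := exists_min_max hK hne w
    have hDw := h i
    have hpos := fun z : HypSpace n => B_pos_of_snd_pos z hw.ge hw2
    rw [horosphericalWidth_eq hi hx hp hmax hmin] at hDw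
    refine ⟨x, hx, p, hp, le_antisymm (dist_le_of_horosphericalWidth_eq hD hK h hx hp) ?_⟩
    rw [← hDw, log_le_iff_le_exp (div_pos (hpos x) (hpos p)), div_le_iff₀ (hpos p)]
    exact B_le_exp_dist_mul x p hw hw2
  · rintro _ ⟨x, hx, y, hy, rfl⟩
    exact dist_le_of_horosphericalWidth_eq hD hK h hx hy
  · rintro p v ⟨hpf, hv, hsub⟩
    have hp : p ∈ K := hK.isClosed.frontier_subset hpf
    obtain ⟨q, hq, hqe⟩ := exists_mem_eq_geodesic_of_horosphericalWidth_eq hD hK h hp hv hsub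
    exact ⟨q, hqe, hconv p hp q hq⟩

end Main

end Hyp

theorem proposition5p1 (n : ℕ) (hn : 1 ≤ n) (D : ℝ) (hD : 0 < D)
    (K : Set (Hyp.HypSpace n)) (hK : IsCompact K) (hconv : Hyp.IsConvex K) :
    Hyp.IsConstantWidth K D ↔ ∀ i : Hyp.IdealPoint n, Hyp.horosphericalWidth i K = D :=
  ⟨fun h => h.horosphericalWidth_eq,
    Hyp.isConstantWidth_of_horosphericalWidth_eq hn hD hK hconv⟩
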